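/- Let $\alpha,\tau>0$ be real numbers and $N$ a natural number with $\alpha\tau N=1$. On $\mathbf{P}^1$ let $\omega_0=\frac{i\,dz\wedge d\bar z}{(1+|z|^2)^2}$ be the Fubini–Study form of volume $2\pi$, with associated metric $g_0$ and Laplacian $\Delta_{\omega_0}\eta=\operatorname{tr}_{\omega_0}(-2i\partial\bar\partial\eta)$, and let $h_0=h_{FS}^N$ be the Hermitian metric on $L=\mathcal{O}_{\mathbf{P}^1}(N)$ with $h_{FS}=\frac{1}{1+|z|^2}$. Let $\phi$ be a holomorphic section of $L$ with zero divisor $\sum_{j=1}^d n_jp_j$ ($p_j$ distinct) which is polystable, i.e. either stable ($\phi\not\equiv0$ and $n_j<N/2$ for all $j$) or strictly polystable ($d=2$ and $n_1=n_2$). Put $u_0=\log|\phi|_{h_0}^2$, with value $-\infty$ at the zeros of $\phi$. For $i\in\mathbf{N}$ let $\lambda_i>0$ and let $v_{\lambda_i}:\mathbf{P}^1\to\mathbf{R}$ be a smooth solution of $$\Delta_{\omega_0}v_{\lambda_i}=\frac1{\lambda_i}\left(\tau-|\phi|_{h_0}^2e^{v_{\lambda_i}}\right)e^{2\alpha\tau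 v_{\lambda_i}-2\alpha|\phi|_{h_0}^2e^{v_{\lambda_i}}}-2N ,$$ and let $g_{\lambda_i}=\frac1{\lambda_i}e^{2\alpha\tau v_{\lambda_i}-2\alpha|\phi|_{h_0}^2e^{v_{\lambda_i}}}g_0$. If $\operatorname{Vol}_{g_{\lambda_i}}\to+\infty$ as $i\to\infty$, then $$\lim_{i\to\infty}\ \sup_{\mathbf{P}^1}\left(v_{\lambda_i}+u_0-\log\tau\right)=0 .$$ Equivalently, the state function $|\phi|_{h_0}^2e^{v_{\lambda_i}}$ attains a maximum on $\mathbf{P}^1$ for every $i$, and these maxima tend to $\tau$. -/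

import Mathlib

open Filter Topology MeasureTheory
open scoped ContDiff

noncomputable section

namespace EinsteinBogomolnyi

/-- The complex projective line, as the set of lines in `ℂ²`. -/
abbrev P1 : Type := Projectivization ℂ (Fin 2 → ℂ)

lemma vec_one_ne_zero (z : ℂ) : (![1, z] : Fin 2 → ℂ) ≠ 0 := fun h => by
  simpa using congrFun h 0

lemma vec_ne_zero_one (w : ℂ) : (![w, 1] : Fin 2 → ℂ) ≠ 0 := fun h => by
  simpa using congrFun h 1

/-- The affine chart `z ↦ [1 : z]`; it misses only the point `[0 : 1]`. -/
def chart₀ (z : ℂ) : P1 := Projectivization.mk ℂ ![1, z] (vec_one_ne_zero z)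

/-- The affine chart `w ↦ [w : 1]`, around `[0 : 1]`; on the overlap `w = 1 / z`. -/
def chart₁ (w : ℂ) : P1 := Projectivization.mk ℂ ![w, 1] (vec_ne_zero_one w)

/-- The affine coordinate `z = z₁ / z₀` of a point `[z₀ : z₁]` with `z₀ ≠ 0`. -/
def coord₀ (p : P1) : ℂ := p.rep 1 / p.rep 0

/-- Smooth real functions on the projective line: smooth in both affine charts. -/
def IsSmooth (η : P1 → ℝ) : Prop :=
  ContDiff ℝ ∞ (fun z : ℂ => η (chart₀ z)) ∧ ContDiff ℝ ∞ (fun w : ℂ => η (chart₁ w))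

/-- The (nonnegative) Laplacian `Δ_{ω₀} η = tr_{ω₀} (-2 i ∂∂̄ η)` of the Fubini-Study form
`ω₀ = i dz ∧ dz̄ / (1 + |z|²)²`. In the coordinate `z` it is
`-2 (1 + |z|²)² ∂_z ∂_z̄ η = -(1/2) (1 + |z|²)² (η_xx + η_yy)`, and the same formula holds in the
coordinate `w`, which is used at the single point `w = 0` that the first chart misses. -/
def fsLaplacian (η : P1 → ℝ) (p : P1) : ℝ :=
  open Classical in
  if p.rep 0 ≠ 0 then
    -(1 / 2) * (1 + ‖coord₀ p‖ ^ 2) ^ 2 *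
      Laplacian.laplacian (fun z : ℂ => η (chart₀ z)) (coord₀ p)
  else
    -(1 / 2) * Laplacian.laplacian (fun w : ℂ => η (chart₁ w)) 0

/-- The volume `∫ ρ ω₀` of the metric `ρ ω₀`, where `ω₀` is the Fubini-Study form
`i dz ∧ dz̄ / (1 + |z|²)² = 2 dx ∧ dy / (1 + |z|²)²`, of total volume `2π`. It is computed in
the affine chart `chart₀`, whose complement is one point. -/
def conformalVolume (ρ : P1 → ℝ) : ℝ :=
  ∫ z : ℂ, ρ (chart₀ z) * (2 / (1 + ‖z‖ ^ 2) ^ 2)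

/-- Holomorphic sections of the line bundle `𝒪(N)` of degree `N` on the projective line, as
holomorphic functions on `ℂ² ∖ {0}` that are homogeneous of degree `N`. (In the two charts the
section is `s₀ z = φ (1, z)` and `s₁ w = φ (w, 1)`, with `s₀ z = z ^ N * s₁ (1 / z)`.) -/
structure HoloSection (N : ℕ) where
  /-- The underlying homogeneous function. -/
  toFun : (Fin 2 → ℂ) → ℂ
  holomorphic : DifferentiableOn ℂ toFun {0}ᶜ
  homogeneous : ∀ (c : ℂ) (x : Fin 2 → ℂ), c ≠ 0 → x ≠ 0 → toFun (c • x) = c ^ N * toFun x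

namespace HoloSection

variable {N : ℕ}

/-- The pointwise norm squared `|φ|²_{h₀}` for the metric `h₀ = h_FS ^ N`, which at `[z₀ : z₁]` is
`|φ(z₀, z₁)|² / (|z₀|² + |z₁|²) ^ N`. In the chart `z` this is `|s₀ z|² / (1 + |z|²) ^ N`. -/
def normSq₀ (φ : HoloSection N) (p : P1) : ℝ :=
  ‖φ.toFun p.rep‖ ^ 2 / (‖p.rep 0‖ ^ 2 + ‖p.rep 1‖ ^ 2) ^ N

/-- The order of vanishing of `φ` at a point, that is, the multiplicity of the point in the divisor
`[φ = 0]`: the order of the local holomorphic function representing `φ` in an affine chart. It is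
`0` where `φ` does not vanish, and `⊤` everywhere for the zero section. -/
def ord (φ : HoloSection N) (p : P1) : ℕ∞ :=
  open Classical in
  if p.rep 0 ≠ 0 then analyticOrderAt (fun z : ℂ => φ.toFun ![1, z]) (coord₀ p)
  else analyticOrderAt (fun w : ℂ => φ.toFun ![w, 1]) 0

/-- `φ` is stable: all its zeros have multiplicity `< N / 2`. -/
def IsStable (φ : HoloSection N) : Prop :=
  ∀ p : P1, 2 * φ.ord p < N

/-- `φ` is strictly polystable: it has exactly two distinct zeros, with equal multiplicities. -/
def IsStrictlyPolystable (φ : HoloSection N) : Prop :=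
  ∃ p q : P1, p ≠ q ∧ {x : P1 | φ.ord x ≠ 0} = {p, q} ∧ φ.ord p = φ.ord q

/-- `φ` is polystable: stable or strictly polystable. -/
def IsPolystable (φ : HoloSection N) : Prop :=
  φ.IsStable ∨ φ.IsStrictlyPolystable

/-- The function `u₀ = log |φ|²_{h₀}`, with value `-∞` at the zeros of `φ`. -/
def u₀ (φ : HoloSection N) (p : P1) : EReal :=
  ENNReal.log (ENNReal.ofReal (φ.normSq₀ p))

/-- The state function `|φ|²_h` of the Hermitian metric `h = h₀ e ^ v`. -/
def stateFunction (φ : HoloSection N) (v : P1 → ℝ) (p : P1) : ℝ :=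
  φ.normSq₀ p * Real.exp (v p)

/-- The conformal factor of the metric
`g_λ = (1 / λ) exp (2 α τ v - 2 α |φ|²_{h₀} e ^ v) g₀` determined by `v`. -/
def conformalFactor (φ : HoloSection N) (α τ lam : ℝ) (v : P1 → ℝ) (p : P1) : ℝ :=
  1 / lam * Real.exp (2 * α * τ * v p - 2 * α * φ.stateFunction v p)

/-- `v` is a (smooth) solution of the Einstein-Bogomol'nyi equation with parameter `λ`,
`Δ_{ω₀} v = (1 / λ) (τ - |φ|² e ^ v) exp (2 α τ v - 2 α |φ|² e ^ v) - 2 N`. -/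
def IsSolution (φ : HoloSection N) (α τ lam : ℝ) (v : P1 → ℝ) : Prop :=
  IsSmooth v ∧ ∀ p : P1, fsLaplacian v p =
    1 / lam * (τ - φ.normSq₀ p * Real.exp (v p)) *
      Real.exp (2 * α * τ * v p - 2 * α * (φ.normSq₀ p * Real.exp (v p))) - 2 * N

end HoloSection

end EinsteinBogomolnyi

end

namespace EinsteinBogomolnyi

open Laplacian

/-! Let `M i` be the maximum of the state function `|φ|²_h`. It is squeezed between `τ - C / Vol`
and `τ`.

Upper bound: at a nonzero maximum, `log |φ|²_h = v + 2 log |s| - N log (1 + |z|²)` in a chart, and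
`log |s|` is harmonic there. The maximum principle leaves only the curvature term, so `Δ v ≥ -2N`.
The equation then makes `(τ - M)` times a positive conformal factor nonnegative
(`IsSolution.stateFunction_le`).

Lower bound: the Laplacian of a smooth function has integral zero, so integrating the equation gives
`∫ (τ - |φ|²_h) dvol_g = 2N ∫ ω₀`. The left side is at least `(τ - M) Vol_g`
(`IsSolution.sub_mul_conformalVolume_le`), and `Vol_g → ∞`.

The supremum statement is the logarithm of `M i → τ`. -/

/-! ### Second derivatives in the plane and the maximum principle. -/

lemma laplacian_complex_eq_fderiv (f : ℂ → ℝ) (z : ℂ) :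
    Δ f z = fderiv ℝ (fderiv ℝ f) z 1 1 + fderiv ℝ (fderiv ℝ f) z Complex.I Complex.I := by
  simp [InnerProductSpace.laplacian_eq_iteratedFDeriv_complexPlane, iteratedFDeriv_two_apply]

lemma deriv_deriv_line {f : ℂ → ℝ} {z : ℂ} (hf : ContDiffAt ℝ 2 f z) (e : ℂ) :
    deriv (deriv (fun t : ℝ => f (z + t • e))) 0 = fderiv ℝ (fderiv ℝ f) z e e := by
  have hline : ∀ t : ℝ, HasDerivAt (fun t : ℝ => z + t • e) e t := fun t => by
    simpa using ((hasDerivAt_id t).smul_const e).const_add z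
  have hcont : Tendsto (fun t : ℝ => z + t • e) (𝓝 0) (𝓝 z) := by
    simpa using (hline 0).continuousAt.tendsto
  have h1 : deriv (fun t : ℝ => f (z + t • e)) =ᶠ[𝓝 0] fun t => fderiv ℝ f (z + t • e) e := by
    filter_upwards [hcont.eventually (hf.eventually (by simp))] with t ht
    exact ((ht.differentiableAt (by simp)).hasFDerivAt.comp_hasDerivAt t (hline t)).deriv
  rw [h1.deriv_eq]
  have h2 : DifferentiableAt ℝ (fderiv ℝ f) z :=
    (hf.fderiv_right (m := 1) (by norm_num)).differentiableAt (by simp)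
  have h3 : HasFDerivAt (fderiv ℝ f) (fderiv ℝ (fderiv ℝ f) z) (z + (0 : ℝ) • e) := by
    simpa using h2.hasFDerivAt
  have h4 := h3.comp_hasDerivAt (0 : ℝ) (hline 0)
  exact (h4.clm_apply (hasDerivAt_const (0 : ℝ) e)).deriv.trans (by simp)

/-- The second derivative is nonpositive at a local maximum. -/
lemma deriv_deriv_nonpos_of_isLocalMax {g : ℝ → ℝ} {x : ℝ} (hg : ContinuousAt g x)
    (hmax : IsLocalMax g x) : deriv (deriv g) x ≤ 0 := by
  by_contra! h
  -- A positive second derivative would also make `x` a local minimum, so `g` would be constant near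
  -- `x`.
  have hmin := isLocalMin_of_deriv_deriv_pos h hmax.deriv_eq_zero hg
  have hc : g =ᶠ[𝓝 x] fun _ => g x := by
    filter_upwards [hmin, hmax] with y h1 h2 using le_antisymm h2 h1
  have h' : deriv g =ᶠ[𝓝 x] fun _ => 0 := by simpa using hc.deriv
  rw [h'.deriv_eq] at h
  simp at h

lemma laplacian_nonpos_of_isLocalMax {f : ℂ → ℝ} {z : ℂ} (hf : ContDiffAt ℝ 2 f z)
    (hmax : IsLocalMax f z) : Δ f z ≤ 0 := by
  have key : ∀ e : ℂ, fderiv ℝ (fderiv ℝ f) z e e ≤ 0 := fun e => by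
    have hc : ContinuousAt (fun t : ℝ => z + t • e) 0 := by fun_prop
    have hz : z + (0 : ℝ) • e = z := by simp
    rw [← deriv_deriv_line hf e]
    refine deriv_deriv_nonpos_of_isLocalMax
      (ContinuousAt.comp (f := fun t : ℝ => z + t • e) (by rw [hz]; exact hf.continuousAt) hc) ?_
    have h1 : Tendsto (fun t : ℝ => z + t • e) (𝓝 0) (𝓝 z) := by simpa using hc.tendsto
    filter_upwards [h1.eventually hmax] with t ht
    simpa using ht
  rw [laplacian_complex_eq_fderiv]
  linarith [key 1, key Complex.I]

/-- This is `log (1 + ‖z‖²)` along a unit-speed line: `c = 1 + ‖z‖²`, and `b` is the component of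
`z` in that direction. -/
lemma deriv_deriv_log_quadratic {b c : ℝ} (hpos : ∀ t : ℝ, 0 < c + 2 * b * t + t ^ 2) :
    deriv (deriv (fun t : ℝ => Real.log (c + 2 * b * t + t ^ 2))) 0
      = 2 / c - 4 * b ^ 2 / c ^ 2 := by
  have hq : ∀ t : ℝ, HasDerivAt (fun t : ℝ => c + 2 * b * t + t ^ 2) (2 * b + 2 * t) t :=
    fun t => by
      have := (((hasDerivAt_id' t).const_mul (2 * b)).const_add c).fun_add (hasDerivAt_pow 2 t)
      simpa using this
  have h1 : deriv (fun t : ℝ => Real.log (c + 2 * b * t + t ^ 2))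
      = fun t => (2 * b + 2 * t) / (c + 2 * b * t + t ^ 2) :=
    funext fun t => ((hq t).log (hpos t).ne').deriv
  have hl : HasDerivAt (fun t : ℝ => 2 * b + 2 * t) 2 0 := by
    simpa using ((hasDerivAt_id (0 : ℝ)).const_mul 2).const_add (2 * b)
  have hc : c ≠ 0 := by simpa using (hpos 0).ne'
  rw [h1, (hl.fun_div (hq 0) (hpos 0).ne').deriv]
  simp only [mul_zero, add_zero, ne_eq, OfNat.ofNat_ne_zero, not_false_eq_true, zero_pow]
  field_simp
  ring

lemma contDiff_log_one_add_norm_sq :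
    ContDiff ℝ 2 (fun z : ℂ => Real.log (1 + ‖z‖ ^ 2)) :=
  (contDiff_const.add (contDiff_norm_sq ℝ)).log fun z => by positivity

/-- The function is a Kähler potential of the Fubini-Study form. The two directions add up to `4 / c
- 4 (c - 1) / c²` with `c = 1 + ‖z‖²`. -/
lemma laplacian_log_one_add_norm_sq (z : ℂ) :
    Δ (fun z : ℂ => Real.log (1 + ‖z‖ ^ 2)) z = 4 / (1 + ‖z‖ ^ 2) ^ 2 := by
  have hd := contDiff_log_one_add_norm_sq.contDiffAt (x := z)
  have hn : ‖z‖ ^ 2 = z.re ^ 2 + z.im ^ 2 := by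
    rw [Complex.sq_norm, Complex.normSq_apply]; ring
  have e1 : (fun t : ℝ => Real.log (1 + ‖z + t • (1 : ℂ)‖ ^ 2))
      = fun t => Real.log ((1 + ‖z‖ ^ 2) + 2 * z.re * t + t ^ 2) := by
    funext t
    congr 1
    rw [Complex.sq_norm, Complex.normSq_apply, hn]
    simp
    ring
  have e2 : (fun t : ℝ => Real.log (1 + ‖z + t • Complex.I‖ ^ 2))
      = fun t => Real.log ((1 + ‖z‖ ^ 2) + 2 * z.im * t + t ^ 2) := by
    funext t
    congr 1
    rw [Complex.sq_norm, Complex.normSq_apply, hn]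
    simp
    ring
  rw [laplacian_complex_eq_fderiv, ← deriv_deriv_line hd, ← deriv_deriv_line hd, e1, e2,
    deriv_deriv_log_quadratic (fun t => by rw [hn]; nlinarith [sq_nonneg (z.re + t), sq_nonneg z.im]),
    deriv_deriv_log_quadratic (fun t => by rw [hn]; nlinarith [sq_nonneg (z.im + t), sq_nonneg z.re])]
  have : (1 + ‖z‖ ^ 2) ≠ 0 := by positivity
  field_simp
  rw [hn]
  ring

/-- The maximum principle for `log (‖s‖² e^w / (1 + ‖z‖²)^N)` with `s` holomorphic. -/
lemma laplacian_le_of_isLocalMax {N : ℕ} {s : ℂ → ℂ} {w : ℂ → ℝ} {z : ℂ}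
    (hs : AnalyticAt ℂ s z) (hs0 : s z ≠ 0) (hw : ContDiffAt ℝ 2 w z)
    (hmax : IsLocalMax (fun x => ‖s x‖ ^ 2 / (1 + ‖x‖ ^ 2) ^ N * Real.exp (w x)) z) :
    Δ w z ≤ 4 * N / (1 + ‖z‖ ^ 2) ^ 2 := by
  obtain ⟨hl, hl0⟩ := hs.harmonicAt_log_norm hs0
  have hk := contDiff_log_one_add_norm_sq.contDiffAt (x := z)
  set l : ℂ → ℝ := fun x => Real.log ‖s x‖
  set k : ℂ → ℝ := fun x => Real.log (1 + ‖x‖ ^ 2)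
  have hlog : ∀ᶠ x in 𝓝 z, Real.log (‖s x‖ ^ 2 / (1 + ‖x‖ ^ 2) ^ N * Real.exp (w x))
      = (w + (2 : ℝ) • l - (N : ℝ) • k) x := by
    filter_upwards [hs.continuousAt.eventually_ne hs0] with x hx
    have h1 : ‖s x‖ ≠ 0 := by simpa using hx
    have h2 : (1 + ‖x‖ ^ 2) ≠ 0 := by positivity
    rw [Real.log_mul (by positivity) (Real.exp_ne_zero _), Real.log_div (by positivity)
      (by positivity), Real.log_pow, Real.log_pow, Real.log_exp]
    simp [l, k]
    ring
  have hmax' : IsLocalMax (w + (2 : ℝ) • l - (N : ℝ) • k) z := by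
    filter_upwards [hmax, hlog, hs.continuousAt.eventually_ne hs0] with x h1 h2 h3
    rw [← h2, ← hlog.self_of_nhds]
    exact Real.log_le_log (by positivity) h1
  have h2l : ContDiffAt ℝ 2 ((2 : ℝ) • l) z := contDiffAt_const.smul hl
  have hNk : ContDiffAt ℝ 2 ((N : ℝ) • k) z := contDiffAt_const.smul hk
  have hadd : ContDiffAt ℝ 2 (w + (2 : ℝ) • l) z := hw.add h2l
  have h := laplacian_nonpos_of_isLocalMax (f := w + (2 : ℝ) • l - (N : ℝ) • k) (hadd.sub hNk) hmax'
  rw [hadd.laplacian_sub hNk, hw.laplacian_add h2l,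
    InnerProductSpace.laplacian_smul _ hl, InnerProductSpace.laplacian_smul _ hk,
    hl0.self_of_nhds, laplacian_log_one_add_norm_sq] at h
  simp only [Pi.zero_apply, smul_eq_mul, mul_zero, add_zero] at h
  rw [mul_comm, mul_div_assoc]
  linarith

/-! ### Integration by parts in the plane. -/

lemma continuous_fderiv_fderiv_apply {f : ℂ → ℝ} (hf : ContDiff ℝ 2 f) (e : ℂ) :
    Continuous fun z => fderiv ℝ (fderiv ℝ f) z e e :=
  (((hf.fderiv_right (m := 1) (by norm_num)).continuous_fderiv (by simp)).clm_apply
    continuous_const).clm_apply continuous_const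

lemma continuous_laplacian {f : ℂ → ℝ} (hf : ContDiff ℝ 2 f) : Continuous (Δ f) := by
  rw [show Δ f = _ from funext (laplacian_complex_eq_fderiv f)]
  exact (continuous_fderiv_fderiv_apply hf 1).add (continuous_fderiv_fderiv_apply hf Complex.I)

lemma fderiv_fderiv_apply {f : ℂ → ℝ} (hf : ContDiff ℝ 2 f) (z e : ℂ) :
    fderiv ℝ (fun x => fderiv ℝ f x e) z e = fderiv ℝ (fderiv ℝ f) z e e := by
  rw [fderiv_clm_apply ((hf.fderiv_right (m := 1) (by norm_num)).differentiable (by simp) z)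
    (differentiableAt_const e)]
  simp

/-- Two integrations by parts; the compact support of `χ` supplies every integrability condition. -/
lemma integral_mul_fderiv_fderiv {χ f : ℂ → ℝ} (hχ : ContDiff ℝ 2 χ)
    (hsupp : HasCompactSupport χ) (hf : ContDiff ℝ 2 f) (e : ℂ) :
    ∫ z, χ z * fderiv ℝ (fderiv ℝ f) z e e = ∫ z, fderiv ℝ (fderiv ℝ χ) z e e * f z := by
  have hχ1 : ContDiff ℝ 1 fun z => fderiv ℝ χ z e :=
    (hχ.fderiv_right (m := 1) (by norm_num)).clm_apply contDiff_const
  have hf1 : ContDiff ℝ 1 fun z => fderiv ℝ f z e :=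
    (hf.fderiv_right (m := 1) (by norm_num)).clm_apply contDiff_const
  have hs1 : HasCompactSupport fun z => fderiv ℝ χ z e := hsupp.fderiv_apply (𝕜 := ℝ) e
  have hs2 : HasCompactSupport fun z => fderiv ℝ (fun z => fderiv ℝ χ z e) z e :=
    hs1.fderiv_apply (𝕜 := ℝ) e
  have c1 : Continuous fun z => fderiv ℝ (fun z => fderiv ℝ f z e) z e :=
    (hf1.continuous_fderiv (by simp)).clm_apply continuous_const
  have c2 : Continuous fun z => fderiv ℝ (fun z => fderiv ℝ χ z e) z e :=
    (hχ1.continuous_fderiv (by simp)).clm_apply continuous_const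
  simp only [← fderiv_fderiv_apply hf, ← fderiv_fderiv_apply hχ]
  rw [integral_mul_fderiv_eq_neg_fderiv_mul_of_integrable (f := χ) (g := fun z => fderiv ℝ f z e)
      ((hχ1.continuous.mul hf1.continuous).integrable_of_hasCompactSupport hs1.mul_right)
      ((hχ.continuous.mul c1).integrable_of_hasCompactSupport hsupp.mul_right)
      ((hχ.continuous.mul hf1.continuous).integrable_of_hasCompactSupport hsupp.mul_right)
      (fun x _ => hχ.differentiable (by simp) x) (fun x _ => hf1.differentiable (by simp) x),
    integral_mul_fderiv_eq_neg_fderiv_mul_of_integrable (f := fun z => fderiv ℝ χ z e) (g := f)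
      ((c2.mul hf.continuous).integrable_of_hasCompactSupport hs2.mul_right)
      ((hχ1.continuous.mul hf1.continuous).integrable_of_hasCompactSupport hs1.mul_right)
      ((hχ1.continuous.mul hf.continuous).integrable_of_hasCompactSupport hs1.mul_right)
      (fun x _ => hχ1.differentiable (by simp) x) (fun x _ => hf.differentiable (by simp) x),
    neg_neg]

lemma hasCompactSupport_fderiv_fderiv_apply {χ : ℂ → ℝ} (hsupp : HasCompactSupport χ) (e : ℂ) :
    HasCompactSupport fun z => fderiv ℝ (fderiv ℝ χ) z e e :=
  ((hsupp.fderiv ℝ).fderiv ℝ).comp_left (g := fun L : ℂ →L[ℝ] ℂ →L[ℝ] ℝ => L e e) (by simp)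

/-- Green's identity against a compactly supported function. -/
lemma integral_mul_laplacian {χ f : ℂ → ℝ} (hχ : ContDiff ℝ 2 χ)
    (hsupp : HasCompactSupport χ) (hf : ContDiff ℝ 2 f) :
    ∫ z, χ z * Δ f z = ∫ z, Δ χ z * f z := by
  simp only [laplacian_complex_eq_fderiv, mul_add, add_mul]
  rw [integral_add, integral_add, integral_mul_fderiv_fderiv hχ hsupp hf,
    integral_mul_fderiv_fderiv hχ hsupp hf]
  · exact ((continuous_fderiv_fderiv_apply hχ 1).mul
      hf.continuous).integrable_of_hasCompactSupport
      (hasCompactSupport_fderiv_fderiv_apply hsupp 1).mul_right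
  · exact ((continuous_fderiv_fderiv_apply hχ Complex.I).mul
      hf.continuous).integrable_of_hasCompactSupport
      (hasCompactSupport_fderiv_fderiv_apply hsupp Complex.I).mul_right
  · exact (hχ.continuous.mul
      (continuous_fderiv_fderiv_apply hf 1)).integrable_of_hasCompactSupport hsupp.mul_right
  · exact (hχ.continuous.mul
      (continuous_fderiv_fderiv_apply hf Complex.I)).integrable_of_hasCompactSupport hsupp.mul_right

lemma laplacian_comp_smul (f : ℂ → ℝ) (R : ℝ) (z : ℂ) :
    Δ (fun x : ℂ => f (R • x)) z = R ^ 2 * Δ f (R • z) := by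
  have h1 : fderiv ℝ (fun x : ℂ => f (R • x)) = fun x => R • fderiv ℝ f (R • x) :=
    funext fun x => fderiv_comp_smul R
  have h2 : ∀ x, fderiv ℝ (fun x : ℂ => R • fderiv ℝ f (R • x)) x
      = R • R • fderiv ℝ (fderiv ℝ f) (R • x) := fun x => by
    rw [← fderiv_comp_smul]
    exact congrFun (fderiv_const_smul_field (f := fun x : ℂ => fderiv ℝ f (R • x)) R) x
  rw [laplacian_complex_eq_fderiv, laplacian_complex_eq_fderiv, h1, h2]
  simp
  ring

/-- The Laplacian of a bounded function with a limit at infinity has integral zero as soon as it is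
integrable. -/
lemma integral_laplacian_eq_zero {f : ℂ → ℝ} (hf : ContDiff ℝ 2 f) {c B : ℝ}
    (hB : ∀ z, ‖f z‖ ≤ B) (hlim : Tendsto f (cocompact ℂ) (𝓝 c)) (hint : Integrable (Δ f)) :
    ∫ z, Δ f z = 0 := by
  obtain ⟨χ, hχ, hsupp, hχ0, hχ1, hone⟩ : ∃ χ : ℂ → ℝ, ContDiff ℝ 2 χ ∧ HasCompactSupport χ ∧
      (∀ z, 0 ≤ χ z) ∧ (∀ z, χ z ≤ 1) ∧ χ 0 = 1 :=
    let χ : ContDiffBump (0 : ℂ) := ⟨1, 2, one_pos, one_lt_two⟩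
    ⟨χ, χ.contDiff, χ.hasCompactSupport, fun _ => χ.nonneg, fun _ => χ.le_one,
      χ.one_of_mem_closedBall (by simp [χ])⟩
  have hR : Tendsto (fun n : ℕ => (n : ℝ) + 1) atTop atTop :=
    tendsto_atTop_add_const_right _ _ tendsto_natCast_atTop_atTop
  -- Green's identity with the cutoff `χ (z / (n + 1))`, after rescaling. In real dimension two the
  -- Jacobian cancels the factor `(n + 1)²` from the Laplacian, and subtracting `c` does not change
  -- `Δ f`.
  have hgreen : ∀ n : ℕ, ∫ z, χ ((((n : ℝ) + 1)⁻¹) • z) * Δ f z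
      = ∫ z, Δ χ z * (f (((n : ℝ) + 1) • z) - c) := fun n => by
    have hpos : (0 : ℝ) < n + 1 := by positivity
    have hfR : ContDiff ℝ 2 fun z : ℂ => f (((n : ℝ) + 1) • z) :=
      hf.comp (contDiff_const_smul _)
    have hg := integral_mul_laplacian hχ hsupp (hfR.sub (contDiff_const (c := c)))
    rw [← hg]
    have hΔ : ∀ z, Δ (fun z : ℂ => f (((n : ℝ) + 1) • z) - c) z
        = ((n : ℝ) + 1) ^ 2 * Δ f (((n : ℝ) + 1) • z) := fun z => by
      have := hfR.contDiffAt.laplacian_sub (x := z) (contDiffAt_const (c := c))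
      rw [InnerProductSpace.laplacian_const, laplacian_comp_smul, Pi.zero_apply, sub_zero] at this
      exact this
    simp only [hΔ]
    have hs := Measure.integral_comp_smul (volume : Measure ℂ)
      (fun z => χ ((((n : ℝ) + 1)⁻¹) • z) * Δ f z) ((n : ℝ) + 1)
    simp only [smul_smul, inv_mul_cancel₀ hpos.ne', one_smul, Complex.finrank_real_complex] at hs
    calc ∫ z, χ ((((n : ℝ) + 1)⁻¹) • z) * Δ f z
        = ((n : ℝ) + 1) ^ 2 * ∫ z, χ z * Δ f (((n : ℝ) + 1) • z) := by
          rw [hs, smul_eq_mul, abs_of_pos (by positivity), ← mul_assoc,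
            mul_inv_cancel₀ (by positivity), one_mul]
      _ = _ := by
          rw [← integral_const_mul]
          exact integral_congr_ae (Eventually.of_forall fun z => by ring)
  have hleft : Tendsto (fun n : ℕ => ∫ z, χ ((((n : ℝ) + 1)⁻¹) • z) * Δ f z) atTop
      (𝓝 (∫ z, Δ f z)) := by
    refine tendsto_integral_of_dominated_convergence (fun z => ‖Δ f z‖) (fun n => ?_) hint.norm
      (fun n => Eventually.of_forall fun z => ?_) (Eventually.of_forall fun z => ?_)
    · exact ((hχ.continuous.comp (continuous_const_smul _)).mul
        (continuous_laplacian hf)).aestronglyMeasurable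
    · rw [norm_mul, Real.norm_of_nonneg (hχ0 _)]
      exact mul_le_of_le_one_left (norm_nonneg _) (hχ1 _)
    · have h0 : Tendsto (fun n : ℕ => (((n : ℝ) + 1)⁻¹) • z) atTop (𝓝 0) := by
        simpa using hR.inv_tendsto_atTop.smul_const z
      have := (hχ.continuous.tendsto 0).comp h0
      rw [hone] at this
      simpa using this.mul_const (Δ f z)
  have hsuppΔ : HasCompactSupport (Δ χ : ℂ → ℝ) := by
    rw [show Δ χ = _ from funext (laplacian_complex_eq_fderiv χ)]
    exact (hasCompactSupport_fderiv_fderiv_apply hsupp 1).add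
      (hasCompactSupport_fderiv_fderiv_apply hsupp Complex.I)
  have hright : Tendsto (fun n : ℕ => ∫ z, Δ χ z * (f (((n : ℝ) + 1) • z) - c)) atTop
      (𝓝 (∫ _ : ℂ, (0 : ℝ))) := by
    refine tendsto_integral_of_dominated_convergence (fun z => ‖Δ χ z‖ * (B + ‖c‖)) (fun n => ?_)
      (((continuous_laplacian hχ).integrable_of_hasCompactSupport hsuppΔ).norm.mul_const _)
      (fun n => Eventually.of_forall fun z => ?_) ?_
    · exact ((continuous_laplacian hχ).mul
        ((hf.continuous.comp (continuous_const_smul _)).sub continuous_const)).aestronglyMeasurable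
    · rw [norm_mul]
      gcongr
      exact (norm_sub_le _ _).trans (by gcongr; exact hB _)
    -- For `z ≠ 0` the point `(n + 1) z` escapes to infinity, where `f - c` tends to zero; the
    -- origin is a null set.
    · filter_upwards [compl_mem_ae_iff.2 (measure_singleton (0 : ℂ))] with z hz
      have h1 : Tendsto (fun n : ℕ => ((n : ℝ) + 1) • z) atTop (cocompact ℂ) := by
        rw [← Metric.cobounded_eq_cocompact, ← tendsto_norm_atTop_iff_cobounded]
        simp only [norm_smul]
        exact (tendsto_norm_atTop_atTop.comp hR).atTop_mul_const (norm_pos_iff.2 hz)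
      simpa using ((hlim.comp h1).sub_const c).const_mul (Δ χ z)
  simp only [hgreen] at hleft
  simpa using tendsto_nhds_unique hleft hright

/-! ### Charts, compactness and integration on the projective line. -/

lemma two_le_smooth : (2 : WithTop ℕ∞) ≤ ∞ := WithTop.coe_le_coe.2 le_top

lemma rep_chart₀ (z : ℂ) : ∃ a : ℂ, a ≠ 0 ∧ (chart₀ z).rep = a • ![1, z] := by
  obtain ⟨a, ha⟩ := Projectivization.exists_smul_eq_mk_rep ℂ ![1, z] (vec_one_ne_zero z)
  exact ⟨a, a.ne_zero, ha.symm⟩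

lemma rep_chart₁ (w : ℂ) : ∃ a : ℂ, a ≠ 0 ∧ (chart₁ w).rep = a • ![w, 1] := by
  obtain ⟨a, ha⟩ := Projectivization.exists_smul_eq_mk_rep ℂ ![w, 1] (vec_ne_zero_one w)
  exact ⟨a, a.ne_zero, ha.symm⟩

lemma chart₀_eq_chart₁_inv {z : ℂ} (hz : z ≠ 0) : chart₀ z = chart₁ z⁻¹ := by
  refine (Projectivization.mk_eq_mk_iff' ℂ _ _ _ _).2 ⟨z, ?_⟩
  ext i
  fin_cases i <;> simp [hz]

lemma eq_chart₀_or_eq_chart₁_zero (p : P1) : (∃ z, p = chart₀ z) ∨ p = chart₁ 0 := by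
  by_cases h : p.rep 0 = 0
  · right
    have h1 : p.rep 1 ≠ 0 := fun h1 => p.rep_nonzero (by ext i; fin_cases i <;> simp [h, h1])
    rw [← p.mk_rep]
    refine (Projectivization.mk_eq_mk_iff' ℂ _ _ _ _).2 ⟨p.rep 1, ?_⟩
    ext i
    fin_cases i <;> simp [h]
  · left
    refine ⟨p.rep 1 / p.rep 0, ?_⟩
    conv_lhs => rw [← p.mk_rep]
    refine (Projectivization.mk_eq_mk_iff' ℂ _ _ _ _).2 ⟨p.rep 0, ?_⟩
    ext i
    fin_cases i <;> simp [mul_div_cancel₀, h]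

/-- The projective line is covered by the closed unit discs of the two charts. -/
lemma exists_chart_norm_le_one (p : P1) :
    (∃ z : ℂ, ‖z‖ ≤ 1 ∧ p = chart₀ z) ∨ ∃ w : ℂ, ‖w‖ ≤ 1 ∧ p = chart₁ w := by
  obtain ⟨z, rfl⟩ | rfl := eq_chart₀_or_eq_chart₁_zero p
  · by_cases hz : ‖z‖ ≤ 1
    · exact .inl ⟨z, hz, rfl⟩
    · push Not at hz
      refine .inr ⟨z⁻¹, ?_, chart₀_eq_chart₁_inv (norm_pos_iff.1 (one_pos.trans hz))⟩
      rw [norm_inv]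
      exact inv_le_one_of_one_le₀ hz.le
  · exact .inr ⟨0, by simp, rfl⟩

/-- A function on the projective line that is continuous in both charts attains its maximum. -/
lemma exists_forall_le {F : P1 → ℝ} (h₀ : Continuous fun z => F (chart₀ z))
    (h₁ : Continuous fun w => F (chart₁ w)) : ∃ p, ∀ q, F q ≤ F p := by
  have hK := isCompact_closedBall (0 : ℂ) 1
  have hne : (Metric.closedBall (0 : ℂ) 1).Nonempty := ⟨0, by simp⟩
  obtain ⟨a, -, ha⟩ := hK.exists_isMaxOn hne h₀.continuousOn
  obtain ⟨b, -, hb⟩ := hK.exists_isMaxOn hne h₁.continuousOn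
  have key : ∀ q, F q ≤ max (F (chart₀ a)) (F (chart₁ b)) := fun q => by
    obtain ⟨z, hz, rfl⟩ | ⟨w, hw, rfl⟩ := exists_chart_norm_le_one q
    · exact le_max_of_le_left (ha (by simpa using hz))
    · exact le_max_of_le_right (hb (by simpa using hw))
  obtain h | h := max_choice (F (chart₀ a)) (F (chart₁ b)) <;> rw [h] at key
  exacts [⟨_, key⟩, ⟨_, key⟩]

lemma exists_norm_le {F : P1 → ℝ} (h₀ : Continuous fun z => F (chart₀ z))
    (h₁ : Continuous fun w => F (chart₁ w)) : ∃ B, ∀ q, ‖F q‖ ≤ B := by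
  obtain ⟨p, hp⟩ := exists_forall_le (F := fun q => ‖F q‖) h₀.norm h₁.norm
  exact ⟨_, hp⟩

lemma fsLaplacian_chart₀ (η : P1 → ℝ) (z : ℂ) :
    fsLaplacian η (chart₀ z) = -(1 / 2) * (1 + ‖z‖ ^ 2) ^ 2 * Δ (fun z => η (chart₀ z)) z := by
  obtain ⟨a, ha, hr⟩ := rep_chart₀ z
  have h0 : (chart₀ z).rep 0 = a := by simp [hr]
  have hc : coord₀ (chart₀ z) = z := by simp [coord₀, hr, ha]
  rw [fsLaplacian, if_pos (by rwa [h0]), hc]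

lemma fsLaplacian_chart₁_zero (η : P1 → ℝ) :
    fsLaplacian η (chart₁ 0) = -(1 / 2) * Δ (fun w => η (chart₁ w)) 0 := by
  obtain ⟨a, ha, hr⟩ := rep_chart₁ 0
  rw [fsLaplacian, if_neg (by simp [hr])]

lemma tendsto_chart₀_cocompact {η : P1 → ℝ} (hη : Continuous fun w => η (chart₁ w)) :
    Tendsto (fun z => η (chart₀ z)) (cocompact ℂ) (𝓝 (η (chart₁ 0))) := by
  have h : Tendsto (fun z : ℂ => η (chart₁ z⁻¹)) (cocompact ℂ) (𝓝 (η (chart₁ 0))) :=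
    by
    rw [← Metric.cobounded_eq_cocompact]
    exact (hη.tendsto 0).comp tendsto_inv₀_cobounded
  refine h.congr' ?_
  filter_upwards [(isCompact_singleton (x := (0 : ℂ))).compl_mem_cocompact] with z hz
  rw [chart₀_eq_chart₁_inv hz]

/-- The density of the Fubini-Study measure in the chart `chart₀` is integrable. -/
lemma integrable_fsDensity : Integrable fun z : ℂ => 2 / (1 + ‖z‖ ^ 2) ^ 2 := by
  -- The exponent is `-r / 2`, so `r = 4` gives the power `-2`; integrability needs `r` above the
  -- real dimension `2`.
  have h := (integrable_rpow_neg_one_add_norm_sq (E := ℂ) (μ := volume) (r := 4)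
    (by rw [Complex.finrank_real_complex]; norm_num)).const_mul 2
  refine h.congr (Eventually.of_forall fun z => ?_)
  have : (-4 / 2 : ℝ) = -((2 : ℕ) : ℝ) := by norm_num
  simp only [this, Real.rpow_neg (by positivity : 0 ≤ 1 + ‖z‖ ^ 2), Real.rpow_natCast]
  rfl

lemma integrable_mul_fsDensity {F : P1 → ℝ} (h₀ : Continuous fun z => F (chart₀ z))
    (h₁ : Continuous fun w => F (chart₁ w)) :
    Integrable fun z : ℂ => F (chart₀ z) * (2 / (1 + ‖z‖ ^ 2) ^ 2) := by
  obtain ⟨B, hB⟩ := exists_norm_le h₀ h₁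
  exact integrable_fsDensity.bdd_mul h₀.aestronglyMeasurable
    (Eventually.of_forall fun z => hB _)

/-- The Laplacian of a smooth function integrates to zero over the projective line. -/
lemma integral_fsLaplacian {η : P1 → ℝ} (hη : IsSmooth η)
    (hint : Integrable fun z : ℂ => fsLaplacian η (chart₀ z) * (2 / (1 + ‖z‖ ^ 2) ^ 2)) :
    ∫ z : ℂ, fsLaplacian η (chart₀ z) * (2 / (1 + ‖z‖ ^ 2) ^ 2) = 0 := by
  -- Conformal invariance in dimension two: the density cancels the weight of the Laplacian.
  have heq : ∀ z : ℂ, fsLaplacian η (chart₀ z) * (2 / (1 + ‖z‖ ^ 2) ^ 2)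
      = -Δ (fun z => η (chart₀ z)) z := fun z => by
    have : (1 + ‖z‖ ^ 2) ≠ 0 := by positivity
    rw [fsLaplacian_chart₀]
    field_simp
  simp only [heq] at hint ⊢
  obtain ⟨B, hB⟩ := exists_norm_le hη.1.continuous hη.2.continuous
  rw [integral_neg, integral_laplacian_eq_zero (hη.1.of_le two_le_smooth)
    (fun z => hB _) (tendsto_chart₀_cocompact hη.2.continuous) (by simpa using hint.neg), neg_zero]

/-! ### Sections, the state function and its two bounds. -/

namespace HoloSection

variable {N : ℕ} (φ : HoloSection N)

/-- Numerator and denominator both scale by `‖a‖ ^ (2N)`, so any homogeneous coordinates may replace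
the chosen `rep`. -/
lemma normSq₀_eq_of_rep_eq_smul {p : P1} {a : ℂ} {x : Fin 2 → ℂ} (ha : a ≠ 0) (hx : x ≠ 0)
    (hp : p.rep = a • x) :
    φ.normSq₀ p = ‖φ.toFun x‖ ^ 2 / (‖x 0‖ ^ 2 + ‖x 1‖ ^ 2) ^ N := by
  have ha' : ‖a‖ ≠ 0 := norm_ne_zero_iff.2 ha
  rw [normSq₀, hp, φ.homogeneous a x ha hx]
  simp only [Pi.smul_apply, smul_eq_mul, norm_mul, norm_pow, mul_pow, ← mul_add]
  rw [← pow_mul, ← pow_mul, mul_comm N 2, mul_div_mul_left _ _ (pow_ne_zero _ ha')]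

lemma normSq₀_chart₀ (z : ℂ) :
    φ.normSq₀ (chart₀ z) = ‖φ.toFun ![1, z]‖ ^ 2 / (1 + ‖z‖ ^ 2) ^ N := by
  obtain ⟨a, ha, hr⟩ := rep_chart₀ z
  rw [φ.normSq₀_eq_of_rep_eq_smul ha (vec_one_ne_zero z) hr]
  simp

lemma normSq₀_chart₁ (w : ℂ) :
    φ.normSq₀ (chart₁ w) = ‖φ.toFun ![w, 1]‖ ^ 2 / (1 + ‖w‖ ^ 2) ^ N := by
  obtain ⟨a, ha, hr⟩ := rep_chart₁ w
  rw [φ.normSq₀_eq_of_rep_eq_smul ha (vec_ne_zero_one w) hr]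
  simp [add_comm]

lemma differentiable_comp_of_ne_zero {g : ℂ → Fin 2 → ℂ} (hg : Differentiable ℂ g)
    (h0 : ∀ z, g z ≠ 0) : Differentiable ℂ fun z => φ.toFun (g z) := fun z =>
  ((φ.holomorphic (g z) (h0 z)).differentiableAt
    (isOpen_compl_singleton.mem_nhds (h0 z))).comp z (hg z)

lemma differentiable_chart₀ : Differentiable ℂ fun z : ℂ => φ.toFun ![1, z] :=
  φ.differentiable_comp_of_ne_zero
    (differentiable_pi.2 fun i => by fin_cases i <;> simp [differentiable_fun_id]) vec_one_ne_zero

lemma differentiable_chart₁ : Differentiable ℂ fun w : ℂ => φ.toFun ![w, 1] :=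
  φ.differentiable_comp_of_ne_zero
    (differentiable_pi.2 fun i => by fin_cases i <;> simp [differentiable_fun_id]) vec_ne_zero_one

lemma continuous_normSq₀_chart₀ : Continuous fun z => φ.normSq₀ (chart₀ z) := by
  simp only [normSq₀_chart₀]
  exact (φ.differentiable_chart₀.continuous.norm.pow 2).div (by fun_prop)
    fun z => by positivity

lemma continuous_normSq₀_chart₁ : Continuous fun w => φ.normSq₀ (chart₁ w) := by
  simp only [normSq₀_chart₁]
  exact (φ.differentiable_chart₁.continuous.norm.pow 2).div (by fun_prop)
    fun z => by positivity

lemma normSq₀_nonneg (p : P1) : 0 ≤ φ.normSq₀ p := by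
  rw [normSq₀]
  positivity

variable {φ} {α τ lam : ℝ} {v : P1 → ℝ}

lemma continuous_stateFunction_chart₀ (hv : IsSmooth v) :
    Continuous fun z => φ.stateFunction v (chart₀ z) :=
  φ.continuous_normSq₀_chart₀.mul hv.1.continuous.rexp

lemma continuous_stateFunction_chart₁ (hv : IsSmooth v) :
    Continuous fun w => φ.stateFunction v (chart₁ w) :=
  φ.continuous_normSq₀_chart₁.mul hv.2.continuous.rexp

lemma continuous_conformalFactor_chart₀ (hv : IsSmooth v) :
    Continuous fun z => φ.conformalFactor α τ lam v (chart₀ z) :=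
  continuous_const.mul ((continuous_const.mul hv.1.continuous).sub
    (continuous_const.mul (continuous_stateFunction_chart₀ hv))).rexp

lemma continuous_conformalFactor_chart₁ (hv : IsSmooth v) :
    Continuous fun w => φ.conformalFactor α τ lam v (chart₁ w) :=
  continuous_const.mul ((continuous_const.mul hv.2.continuous).sub
    (continuous_const.mul (continuous_stateFunction_chart₁ hv))).rexp

lemma conformalFactor_pos (hlam : 0 < lam) (p : P1) : 0 < φ.conformalFactor α τ lam v p :=
  mul_pos (one_div_pos.2 hlam) (Real.exp_pos _)

lemma IsSolution.fsLaplacian_eq (hv : φ.IsSolution α τ lam v) (p : P1) :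
    fsLaplacian v p
      = (τ - φ.stateFunction v p) * φ.conformalFactor α τ lam v p - 2 * N := by
  rw [hv.2 p, conformalFactor, stateFunction]
  ring

/-- At a nonzero local maximum of the state function, `Δ v ≥ -2N`. -/
lemma neg_two_mul_le_fsLaplacian (hv : IsSmooth v) {p : P1}
    (hp : ∀ q, φ.stateFunction v q ≤ φ.stateFunction v p) (hp0 : φ.stateFunction v p ≠ 0) :
    -(2 * N) ≤ fsLaplacian v p := by
  have hne : φ.normSq₀ p ≠ 0 := left_ne_zero_of_mul hp0
  obtain ⟨z, rfl⟩ | rfl := eq_chart₀_or_eq_chart₁_zero p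
  · have hmax : IsLocalMax (fun z => φ.stateFunction v (chart₀ z)) z :=
      Eventually.of_forall fun x => hp _
    simp only [stateFunction, normSq₀_chart₀] at hmax
    rw [normSq₀_chart₀] at hne
    have h := laplacian_le_of_isLocalMax (φ.differentiable_chart₀.analyticAt z)
      (fun h => hne (by simp [h])) (hv.1.contDiffAt.of_le two_le_smooth) hmax
    rw [fsLaplacian_chart₀]
    rw [le_div_iff₀ (by positivity)] at h
    linarith
  · have hmax : IsLocalMax (fun w => φ.stateFunction v (chart₁ w)) 0 :=
      Eventually.of_forall fun x => hp _
    simp only [stateFunction, normSq₀_chart₁] at hmax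
    rw [normSq₀_chart₁] at hne
    have h := laplacian_le_of_isLocalMax (φ.differentiable_chart₁.analyticAt 0)
      (fun h => hne (by simp [h])) (hv.2.contDiffAt.of_le two_le_smooth) hmax
    rw [fsLaplacian_chart₁_zero]
    simp only [norm_zero, ne_eq, OfNat.ofNat_ne_zero, not_false_eq_true, zero_pow, add_zero,
      one_pow, div_one] at h
    linarith

/-- The state function of a solution is bounded above by `τ`. -/
lemma IsSolution.stateFunction_le (hτ : 0 < τ) (hlam : 0 < lam) (hv : φ.IsSolution α τ lam v)
    {p : P1} (hp : ∀ q, φ.stateFunction v q ≤ φ.stateFunction v p) :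
    φ.stateFunction v p ≤ τ := by
  by_cases hp0 : φ.stateFunction v p = 0
  · rw [hp0]
    exact hτ.le
  · have h := neg_two_mul_le_fsLaplacian hv.1 hp hp0
    rw [hv.fsLaplacian_eq] at h
    have h' : 0 ≤ (τ - φ.stateFunction v p) * φ.conformalFactor α τ lam v p := by linarith
    exact sub_nonneg.1 (nonneg_of_mul_nonneg_left h' (conformalFactor_pos hlam p))

/-- The volume of the metric of a solution times `τ - max |φ|²_h` is at most `2N` times the
Fubini-Study volume. -/
lemma IsSolution.sub_mul_conformalVolume_le (hlam : 0 < lam) (hv : φ.IsSolution α τ lam v)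
    {M : ℝ} (hM : ∀ q, φ.stateFunction v q ≤ M) :
    (τ - M) * conformalVolume (φ.conformalFactor α τ lam v)
      ≤ 2 * N * ∫ z : ℂ, 2 / (1 + ‖z‖ ^ 2) ^ 2 := by
  have hc₀ : Continuous fun z => φ.conformalFactor α τ lam v (chart₀ z) :=
    continuous_conformalFactor_chart₀ hv.1
  have hc₁ : Continuous fun w => φ.conformalFactor α τ lam v (chart₁ w) :=
    continuous_conformalFactor_chart₁ hv.1
  have hI := integrable_mul_fsDensity hc₀ hc₁
  have hJ := integrable_mul_fsDensity
    (F := fun p => (τ - φ.stateFunction v p) * φ.conformalFactor α τ lam v p)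
    ((continuous_const.sub (continuous_stateFunction_chart₀ hv.1)).mul hc₀)
    ((continuous_const.sub (continuous_stateFunction_chart₁ hv.1)).mul hc₁)
  have heq : ∀ z : ℂ, fsLaplacian v (chart₀ z) * (2 / (1 + ‖z‖ ^ 2) ^ 2)
      = (τ - φ.stateFunction v (chart₀ z)) * φ.conformalFactor α τ lam v (chart₀ z)
          * (2 / (1 + ‖z‖ ^ 2) ^ 2) - 2 * N * (2 / (1 + ‖z‖ ^ 2) ^ 2) := fun z => by
    rw [hv.fsLaplacian_eq, sub_mul]
  -- The integrated equation, an exact identity; the inequality enters only by replacing the state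
  -- function with `M`.
  have hzero := integral_fsLaplacian hv.1
    (by simpa only [heq] using! hJ.sub (integrable_fsDensity.const_mul _))
  simp only [heq] at hzero
  rw [integral_sub hJ (integrable_fsDensity.const_mul _), integral_const_mul, sub_eq_zero] at hzero
  rw [← hzero, conformalVolume, ← integral_const_mul]
  refine integral_mono (hI.const_mul _) hJ fun z => ?_
  have hpos : 0 ≤ φ.conformalFactor α τ lam v (chart₀ z) * (2 / (1 + ‖z‖ ^ 2) ^ 2) :=
    mul_nonneg (conformalFactor_pos hlam _).le (by positivity)
  simp only [mul_assoc (τ - φ.stateFunction v (chart₀ z))]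
  exact mul_le_mul_of_nonneg_right (by linarith [hM (chart₀ z)]) hpos

lemma add_u₀_eq_log_stateFunction (v : P1 → ℝ) (p : P1) :
    (v p : EReal) + φ.u₀ p = ENNReal.log (ENNReal.ofReal (φ.stateFunction v p)) := by
  rw [stateFunction, ENNReal.ofReal_mul (φ.normSq₀_nonneg p), ENNReal.log_mul_add,
    ENNReal.log_ofReal_of_pos (Real.exp_pos _), Real.log_exp, add_comm, u₀]

/-- The extended logarithm is monotone and the maximum is attained, so the supremum is its value
there; zeros of `φ` contribute `⊥`. -/
lemma iSup_add_u₀_sub_log {M : ℝ} (hM : IsGreatest (Set.range (φ.stateFunction v)) M) (c : EReal) :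
    ⨆ p, ((v p : EReal) + φ.u₀ p - c) = ENNReal.log (ENNReal.ofReal M) - c := by
  simp only [add_u₀_eq_log_stateFunction]
  obtain ⟨p, rfl⟩ := hM.1
  refine le_antisymm (iSup_le fun q => EReal.sub_le_sub ?_ le_rfl)
    (le_iSup (fun q => ENNReal.log (ENNReal.ofReal (φ.stateFunction v q)) - c) p)
  exact ENNReal.log_le_log (ENNReal.ofReal_le_ofReal (hM.2 ⟨q, rfl⟩))

end HoloSection

end EinsteinBogomolnyi

/-! ### The squeeze and the passage to logarithms. -/

theorem mainTheorem8 (α τ : ℝ) (hα : 0 < α) (hτ : 0 < τ) (N : ℕ) (hN : α * τ * N = 1)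
    (φ : EinsteinBogomolnyi.HoloSection N) (hφ : φ.IsPolystable)
    (lam : ℕ → ℝ) (hlam : ∀ i, 0 < lam i)
    (v : ℕ → EinsteinBogomolnyi.P1 → ℝ) (hv : ∀ i, φ.IsSolution α τ (lam i) (v i))
    (hvol : Tendsto
      (fun i => EinsteinBogomolnyi.conformalVolume (φ.conformalFactor α τ (lam i) (v i)))
      atTop atTop) :
    Tendsto
      (fun i => ⨆ p : EinsteinBogomolnyi.P1, ((v i p : EReal) + φ.u₀ p - (Real.log τ : EReal)))
      atTop (𝓝 0) ∧
    ∃ M : ℕ → ℝ, (∀ i, IsGreatest (Set.range (φ.stateFunction (v i))) (M i)) ∧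
      Tendsto M atTop (𝓝 τ) := by
  choose p hp using fun i => EinsteinBogomolnyi.exists_forall_le
    (EinsteinBogomolnyi.HoloSection.continuous_stateFunction_chart₀ (φ := φ) (hv i).1)
    (EinsteinBogomolnyi.HoloSection.continuous_stateFunction_chart₁ (φ := φ) (hv i).1)
  set M : ℕ → ℝ := fun i => φ.stateFunction (v i) (p i)
  have hM : ∀ i, IsGreatest (Set.range (φ.stateFunction (v i))) (M i) := fun i =>
    ⟨⟨p i, rfl⟩, by rintro _ ⟨q, rfl⟩; exact hp i q⟩
  have hlim : Tendsto M atTop (𝓝 τ) := by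
    have hlow : Tendsto (fun i => τ - (2 * N * ∫ z : ℂ, 2 / (1 + ‖z‖ ^ 2) ^ 2) /
        EinsteinBogomolnyi.conformalVolume (φ.conformalFactor α τ (lam i) (v i))) atTop (𝓝 τ) := by
      simpa using (tendsto_const_nhds.div_atTop hvol).const_sub τ
    refine tendsto_of_tendsto_of_tendsto_of_le_of_le' hlow tendsto_const_nhds ?_
      (Eventually.of_forall fun i => (hv i).stateFunction_le hτ (hlam i) (hp i))
    filter_upwards [hvol.eventually_gt_atTop 0] with i hi
    have h := (hv i).sub_mul_conformalVolume_le (hlam i) (hp i)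
    rw [← le_div_iff₀ hi] at h
    linarith
  refine ⟨?_, M, hM, hlim⟩
  have hlog : Tendsto (fun i => Real.log (M i) - Real.log τ) atTop (𝓝 0) := by
    simpa using ((Real.continuousAt_log hτ.ne').tendsto.comp hlim).sub_const (Real.log τ)
  have hE : Tendsto (fun i => ((Real.log (M i) - Real.log τ : ℝ) : EReal)) atTop (𝓝 0) := by
    exact_mod_cast (continuous_coe_real_ereal.tendsto 0).comp hlog
  refine hE.congr' ?_
  -- The extended logarithm of `M i` is the real one only once `M i > 0`, which holds eventually
  -- because `τ > 0`.
  filter_upwards [hlim.eventually (lt_mem_nhds hτ)] with i hi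
  rw [EinsteinBogomolnyi.HoloSection.iSup_add_u₀_sub_log (hM i), ENNReal.log_ofReal_of_pos hi,
    EReal.coe_sub]
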